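/- Let $l\ge 1$ be an integer and $p\in[0,1]$. In the uniform-preferential-attachment (UPA) model with fixed window size $l$, the process starts at time $t=l$ from the star $G^l$ on $v_0,\dots,v_l$ in which each of $v_1,\dots,v_l$ is joined to $v_0$. Given $G^t$ ($t\ge l$), a new vertex $v_{t+1}$ is added and joined by one edge to an existing vertex: with probability $p$ that vertex is chosen uniformly from the window $\{v_{t-l+1},\dots,v_t\}$, and with probability $1-p$ it is $v_j$, $0\le j\le t$, with probability $\deg(v_j)/(2t)$, where $\deg(v_j)$ is the degree of $v_j$ in $G^t$ (all edges at $v_j$ counted). Let $N(k,t)$ be the number of vertices of degree $k$ in $G^t$. **Theorem.** There are deterministic numbers $P(k)$, $k\ge1$, depending only on $l$, $p$ and $k$, such that for every $k\ge 1$ $$\frac{N(k,t)}{t}\longrightarrow P(k)\quad\text{in probability as } t\to\infty .$$ Moreover, with $B(x,y)=\Gamma(x)\Gamma(y)/\Gamma(x+y)$: * If $l=1$, then $$P(1)=\frac{2(1-p)}{3-p},\qquad P(2)=\frac{(1-p)^2}{(2-p)(3-p)}+\frac{p}{2-p},$$ and for $k>2$ $$P(k)=\Big(\frac{2}{1-p}+2\Big)\Big(\frac{2}{1-p}+1\Big)B\Big(k,1+\frac{2}{1-p}\Big)P(2)\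 \text{ if } p<1,\qquad P(k)=0\ \text{ if } p=1 .$$ * If $l>1$, then $$P(1)=\frac{2}{3-p}\Big(1-\frac pl\Big)^l,$$ $$P(k)=\frac{2}{2+k(1-p)}\Big(\frac pl\,(H_{k-1}-H_k)+\frac{(1-p)(k-1)}{2}P(k-1)\Big),\qquad 2\le k\le l+1,$$ and for $k>l+1$ $$P(k)=\frac{B\big(k,\,l+2+\frac{2}{1-p}\big)}{B\big(l+1,\,k+1+\frac{2}{1-p}\big)}\,P(l+1)\ \text{ if } p<1,\qquad P(k)=0\ \text{ if } p=1,$$ where $$H_k=\Big(\frac pl\Big)^{k-1}\sum_{m=1}^{l-(k-1)}\binom{l-m}{l-m-(k-1)}\Big(1-\frac pl\Big)^{l-m-(k-1)}\ \ (1\le k\le l),\qquad H_k=0\ \ (k>l),$$ with the convention $0^0=1$. -/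

import Mathlib

open MeasureTheory ProbabilityTheory Filter

/-- The graph at time `t` on the vertices `v_0, …, v_t`, when `v_i` (for `1 ≤ i ≤ t`) has been
attached, on its arrival, to the vertex with index `a i`.  The value `a 0` plays no role. -/
def upaGraph (a : ℕ → ℕ) (t : ℕ) : SimpleGraph (Fin (t + 1)) :=
  SimpleGraph.fromRel fun i j => 0 < i.val ∧ a i.val = j.val

open Classical in
/-- The degree of `v_j` in the graph at time `t`, all edges at `v_j` being counted. -/
noncomputable def upaDegree (a : ℕ → ℕ) (t : ℕ) (j : Fin (t + 1)) : ℕ :=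
  (upaGraph a t).degree j

open Classical in
/-- `N(k, t)`: the number of vertices of degree `k` in the graph at time `t`. -/
noncomputable def upaCount (a : ℕ → ℕ) (k t : ℕ) : ℕ :=
  (Finset.univ.filter fun j : Fin (t + 1) => upaDegree a t j = k).card

open Classical in
/-- The conditional probability, given the graph at time `t`, that `v_{t+1}` attaches to `v_j`:
with probability `p` the neighbour is uniform in the window `v_{t-l+1}, …, v_t`, and with
probability `1 - p` it is chosen among `v_0, …, v_t` with weights `deg(v_j) / (2 t)`. -/
noncomputable def upaAttachProb (l : ℕ) (p : ℝ) (a : ℕ → ℕ) (t : ℕ) (j : Fin (t + 1)) : ℝ :=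
  p * (if t < j.val + l then 1 / (l : ℝ) else 0)
    + (1 - p) * ((upaDegree a t j : ℝ) / (2 * (t : ℝ)))

/-- `Y` is (the sequence of attachments of) a UPA process with fixed window size `l` and window
probability `p`: `Y i` is the random index of the vertex to which `v_i` attaches on its arrival,
so that the random graph at time `t ≥ l` is `upaGraph (fun i => Y i ω) t`.
* The process starts at time `l` from the star in which `v_1, …, v_l` are attached to `v_0`
  (`Y 0`, which plays no role, is set to `0`).
* For `t ≥ l`, given that the attachments up to time `t` are `a`, the vertex `v_{t+1}` attaches to
  `v_j` with conditional probability `upaAttachProb l p a t j`. -/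
structure IsUPAProcess {Ω : Type*} [MeasurableSpace Ω] (l : ℕ) (p : ℝ) (μ : Measure Ω)
    (Y : ℕ → Ω → ℕ) : Prop where
  measurable : ∀ i, Measurable (Y i)
  init : ∀ i, i ≤ l → ∀ ω, Y i ω = 0
  step : ∀ t, l ≤ t → ∀ (a : ℕ → ℕ) (j : Fin (t + 1)),
    μ.real {ω | (∀ i ≤ t, Y i ω = a i) ∧ Y (t + 1) ω = j.val}
      = upaAttachProb l p a t j * μ.real {ω | ∀ i ≤ t, Y i ω = a i}

/-- The quantities `H_k`, for `k ≥ 1` (zero for `k > l`). -/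
noncomputable def upaH (l : ℕ) (p : ℝ) (k : ℕ) : ℝ :=
  if 1 ≤ k ∧ k ≤ l then
    (p / l) ^ (k - 1) *
      ∑ m ∈ Finset.Icc 1 (l - (k - 1)),
        ((l - m).choose (l - m - (k - 1)) : ℝ) * (1 - p / l) ^ (l - m - (k - 1))
  else 0

/-!
The degree counts are controlled along almost every path of the process, so that the convergence in
probability is obtained from almost sure convergence.

Almost surely every vertex attaches to an earlier one (`IsUPAProcess.ae_lt`), the graph is a tree,
and its degrees satisfy `treeDegree_succ`.  For a bounded functional `F` of the history and of a
vertex, its `innovation`, the value of `F` at the attachment vertex minus the conditional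
expectation of that value, is orthogonal to the past (`IsUPAProcess.integral_mul_innovation`).
Bounded orthogonal variables satisfy a strong law of large numbers
(`ae_cesaroTendsto_zero_of_orthogonal`), hence innovations average to zero over time, and one-step
evolutions may be replaced by their conditional expectations in time averages.

A vertex of the window has degree at most `l`, so preferential attachment reaches it with
probability `O(1 / t)`, and in a step in which it ages from `i` to `i + 1` it gains an edge with
asymptotic rate `p / l`.  By induction on the age, the time average of the indicator that `v_{t-i}`
has degree `k` tends to the binomial weight `windowFreq (p / l) i k`
(`cesaroTendsto_hasDegree_window`); only time averages of the window are needed, no decorrelation.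
The sum of these weights over the window is `H_k` (`upaH_eq_sum_windowFreq`).

The count `N(k + 1, t)` then satisfies `x (t + 1) = (1 - c / t) x t + η t` with
`c = (1 - p) (k + 1) / 2` (`upaCount_succ`), where `η` has converging time averages as soon as
`N(k, t) / t` converges.  The deterministic lemma `tendsto_div_of_recursion` gives the limit of
`x t / t`, and induction on `k` yields `limitFreq` (`tendsto_upaCount_div`).  The closed forms
follow by solving the recursion of `limitFreq` (`limitFreq_eq_Gamma`).
-/

/-! ### Degrees in a recursive tree -/

/-- The degree of `v_j` at time `t`, read off the attachment sequence `a`: one edge to the parent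
unless `j = 0`, and one edge for each later vertex attached to `v_j`.  It agrees with `upaDegree`
when every vertex is attached to an earlier one, see `upaDegree_eq_treeDegree`. -/
def treeDegree (a : ℕ → ℕ) (t j : ℕ) : ℕ :=
  (if 0 < j then 1 else 0) + ((Finset.Icc 1 t).filter fun i => a i = j).card

theorem treeDegree_congr {a b : ℕ → ℕ} {t : ℕ} (h : ∀ i ≤ t, a i = b i) (j : ℕ) :
    treeDegree a t j = treeDegree b t j := by
  unfold treeDegree
  congr 2
  apply Finset.filter_congr
  intro i hi
  rw [h i (Finset.mem_Icc.1 hi).2]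

theorem treeDegree_succ (a : ℕ → ℕ) (t j : ℕ) :
    treeDegree a (t + 1) j = treeDegree a t j + if a (t + 1) = j then 1 else 0 := by
  unfold treeDegree
  rw [← Finset.insert_Icc_right_eq_Icc_add_one (by omega), Finset.filter_insert]
  split_ifs <;> simp_all [add_assoc]

theorem treeDegree_pos (a : ℕ → ℕ) (t : ℕ) {j : ℕ} (hj : 0 < j) : 0 < treeDegree a t j := by
  simp [treeDegree, hj]

theorem treeDegree_le {a : ℕ → ℕ} (ha : ∀ i, 1 ≤ i → a i < i) (t j : ℕ) :
    treeDegree a t j ≤ 1 + (t - j) := by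
  unfold treeDegree
  have h : ((Finset.Icc 1 t).filter fun i => a i = j).card ≤ (Finset.Ioc j t).card := by
    apply Finset.card_le_card
    intro i hi
    simp only [Finset.mem_filter, Finset.mem_Icc, Finset.mem_Ioc] at hi ⊢
    have := ha i hi.1.1
    omega
  rw [Nat.card_Ioc] at h
  split_ifs <;> omega

theorem treeDegree_last {a : ℕ → ℕ} (ha : ∀ i, 1 ≤ i → a i < i) {t : ℕ} (ht : 0 < t) :
    treeDegree a t t = 1 := by
  have h1 := treeDegree_le ha t t
  have h2 := treeDegree_pos a t ht
  omega

theorem sum_treeDegree {a : ℕ → ℕ} {t : ℕ} (ha : ∀ i, 1 ≤ i → i ≤ t → a i < i) :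
    ∑ j ∈ Finset.range (t + 1), treeDegree a t j = 2 * t := by
  unfold treeDegree
  rw [Finset.sum_add_distrib, ← Finset.card_eq_sum_card_fiberwise (f := a)
    (s := Finset.Icc 1 t) (t := Finset.range (t + 1))]
  · rw [Finset.sum_range_succ']
    simp [two_mul]
  · intro i hi
    have h := Finset.mem_Icc.1 (Finset.mem_coe.1 hi)
    have := ha i h.1 h.2
    simp only [Finset.coe_range, Set.mem_Iio]
    omega

theorem upaGraph_adj (a : ℕ → ℕ) (t : ℕ) (i j : Fin (t + 1)) : (upaGraph a t).Adj i j ↔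
    i ≠ j ∧ ((0 < i.val ∧ a i.val = j.val) ∨ (0 < j.val ∧ a j.val = i.val)) :=
  Iff.rfl

theorem upaDegree_eq_treeDegree {a : ℕ → ℕ} {t : ℕ} (ha : ∀ i, 1 ≤ i → i ≤ t → a i < i)
    (j : Fin (t + 1)) : upaDegree a t j = treeDegree a t j := by
  classical
  unfold upaDegree treeDegree
  rw [← SimpleGraph.card_neighborFinset_eq_degree, ← Finset.card_map Fin.valEmbedding]
  have hlt := j.isLt
  have key : ((upaGraph a t).neighborFinset j).map Fin.valEmbedding
      = (if 0 < (j : ℕ) then {a j} else ∅) ∪ (Finset.Icc 1 t).filter fun i => a i = j := by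
    ext i
    simp only [Finset.mem_map, SimpleGraph.mem_neighborFinset, upaGraph_adj,
      Fin.valEmbedding_apply, Finset.mem_union, Finset.mem_filter, Finset.mem_Icc]
    constructor
    · rintro ⟨x, ⟨-, hx | hx⟩, rfl⟩
      · left; simp [hx.1, hx.2]
      · right; exact ⟨⟨hx.1, by omega⟩, hx.2⟩
    · rintro (h | h)
      · split_ifs at h with hj
        · simp only [Finset.mem_singleton] at h
          have := ha j hj (by omega)
          refine ⟨⟨i, by omega⟩, ⟨?_, Or.inl ⟨hj, by simp [h]⟩⟩, rfl⟩
          intro hij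
          have := congrArg Fin.val hij
          simp at this
          omega
        · simp at h
      · have := ha i h.1.1 h.1.2
        refine ⟨⟨i, by omega⟩, ⟨?_, Or.inr ⟨h.1.1, h.2⟩⟩, rfl⟩
        intro hij
        have := congrArg Fin.val hij
        simp at this
        omega
  rw [key, Finset.card_union_of_disjoint]
  · congr 1
    split_ifs <;> simp
  · split_ifs with hj
    · rw [Finset.disjoint_singleton_left]
      intro h
      simp only [Finset.mem_filter, Finset.mem_Icc] at h
      have h1 := ha j hj (by omega)
      have h2 := ha (a j) h.1.1 h.1.2
      omega
    · simp

/-- `upaAttachProb` in terms of `treeDegree`. -/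
noncomputable def treeAttachProb (l : ℕ) (p : ℝ) (a : ℕ → ℕ) (t j : ℕ) : ℝ :=
  p * (if t < j + l then 1 / (l : ℝ) else 0) + (1 - p) * ((treeDegree a t j : ℝ) / (2 * (t : ℝ)))

theorem upaAttachProb_eq {l : ℕ} {p : ℝ} {a : ℕ → ℕ} {t : ℕ}
    (ha : ∀ i, 1 ≤ i → i ≤ t → a i < i) (j : Fin (t + 1)) :
    upaAttachProb l p a t j = treeAttachProb l p a t j := by
  rw [upaAttachProb, treeAttachProb, upaDegree_eq_treeDegree ha]

theorem treeAttachProb_congr {l : ℕ} {p : ℝ} {a b : ℕ → ℕ} {t : ℕ} (h : ∀ i ≤ t, a i = b i)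
    (j : ℕ) : treeAttachProb l p a t j = treeAttachProb l p b t j := by
  rw [treeAttachProb, treeAttachProb, treeDegree_congr h]

theorem treeAttachProb_nonneg {l : ℕ} {p : ℝ} (hp0 : 0 ≤ p) (hp1 : p ≤ 1) (a : ℕ → ℕ) (t j : ℕ) :
    0 ≤ treeAttachProb l p a t j := by
  have : 0 ≤ 1 - p := by linarith
  unfold treeAttachProb
  split_ifs <;> positivity

/-- Summation over the window `v_{t-l+1}, …, v_t`, indexed by the age `i = t - j`. -/
theorem sum_window {l t : ℕ} (hlt : l ≤ t) (f : ℕ → ℝ) :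
    ∑ j ∈ Finset.range (t + 1), (if t < j + l then f j else 0)
      = ∑ i ∈ Finset.range l, f (t - i) := by
  rw [← Finset.sum_range_reflect, ← Finset.sum_filter]
  have : (Finset.range (t + 1)).filter (fun j => t < t + 1 - 1 - j + l) = Finset.range l := by
    ext i
    simp only [Finset.mem_filter, Finset.mem_range]
    omega
  rw [this]
  simp

theorem sum_treeAttachProb_mul {l : ℕ} {p : ℝ} {t : ℕ} (hlt : l ≤ t) (a : ℕ → ℕ) (f : ℕ → ℝ) :
    ∑ j ∈ Finset.range (t + 1), treeAttachProb l p a t j * f j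
      = p / l * ∑ i ∈ Finset.range l, f (t - i)
        + (1 - p) / (2 * t) * ∑ j ∈ Finset.range (t + 1), treeDegree a t j * f j := by
  rw [← sum_window hlt, Finset.mul_sum, Finset.mul_sum, ← Finset.sum_add_distrib]
  refine Finset.sum_congr rfl fun j _ => ?_
  rw [treeAttachProb]
  split_ifs <;> ring

theorem sum_treeAttachProb {l : ℕ} (hl : 1 ≤ l) {p : ℝ} {t : ℕ} (hlt : l ≤ t) {a : ℕ → ℕ}
    (ha : ∀ i, 1 ≤ i → i ≤ t → a i < i) :
    ∑ j ∈ Finset.range (t + 1), treeAttachProb l p a t j = 1 := by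
  have h := sum_treeAttachProb_mul (p := p) hlt a fun _ => 1
  have hs : (∑ j ∈ Finset.range (t + 1), (treeDegree a t j : ℝ)) = 2 * t := by
    exact_mod_cast sum_treeDegree ha
  have hl' : (l : ℝ) ≠ 0 := by positivity
  have ht' : (t : ℝ) ≠ 0 := by
    have : 0 < t := by omega
    positivity
  simp only [mul_one, hs] at h
  rw [h]
  simp
  field_simp
  ring

/-! ### Cesàro limits and a linear recursion -/

/-- The averages `(x 0 + ⋯ + x (n - 1)) / n` converge to `L`. -/
def CesaroTendsto (x : ℕ → ℝ) (L : ℝ) : Prop :=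
  Tendsto (fun n : ℕ => (∑ i ∈ Finset.range n, x i) / n) atTop (nhds L)

namespace CesaroTendsto

theorem of_tendsto {x : ℕ → ℝ} {L : ℝ} (h : Tendsto x atTop (nhds L)) : CesaroTendsto x L := by
  unfold CesaroTendsto
  simpa [div_eq_inv_mul] using h.cesaro

theorem add {x y : ℕ → ℝ} {L M : ℝ} (hx : CesaroTendsto x L) (hy : CesaroTendsto y M) :
    CesaroTendsto (fun n => x n + y n) (L + M) := by
  unfold CesaroTendsto at *
  simpa [Finset.sum_add_distrib, add_div] using Tendsto.add hx hy

theorem const_mul {x : ℕ → ℝ} {L : ℝ} (c : ℝ) (hx : CesaroTendsto x L) :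
    CesaroTendsto (fun n => c * x n) (c * L) := by
  unfold CesaroTendsto at *
  simpa [← Finset.mul_sum, mul_div_assoc] using Tendsto.const_mul c hx

theorem sub {x y : ℕ → ℝ} {L M : ℝ} (hx : CesaroTendsto x L) (hy : CesaroTendsto y M) :
    CesaroTendsto (fun n => x n - y n) (L - M) := by
  unfold CesaroTendsto at *
  simpa [Finset.sum_sub_distrib, sub_div] using Tendsto.sub hx hy

theorem sum {ι : Type*} (s : Finset ι) {x : ι → ℕ → ℝ} {L : ι → ℝ}
    (h : ∀ i ∈ s, CesaroTendsto (x i) (L i)) :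
    CesaroTendsto (fun n => ∑ i ∈ s, x i n) (∑ i ∈ s, L i) := by
  unfold CesaroTendsto at *
  have := tendsto_finsetSum s h
  refine this.congr fun n => ?_
  rw [Finset.sum_comm, Finset.sum_div]

theorem congr {x y : ℕ → ℝ} {L : ℝ} (hx : CesaroTendsto x L) (h : x =ᶠ[atTop] y) :
    CesaroTendsto y L := by
  have h0 : Tendsto (fun n => y n - x n) atTop (nhds 0) := by
    refine tendsto_const_nhds.congr' ?_
    filter_upwards [h] with n hn
    simp [hn]
  simpa using hx.add (of_tendsto h0)

theorem of_succ {x : ℕ → ℝ} {L : ℝ} (hx : CesaroTendsto (fun n => x (n + 1)) L) :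
    CesaroTendsto x L := by
  unfold CesaroTendsto at *
  rw [← tendsto_add_atTop_iff_nat 1]
  have h1 : Tendsto (fun n : ℕ => (n : ℝ) / (n + 1)) atTop (nhds 1) :=
    tendsto_natCast_div_add_atTop 1
  have h2 : Tendsto (fun n : ℕ => x 0 / ((n : ℝ) + 1)) atTop (nhds 0) :=
    tendsto_const_div_atTop_nhds_zero_nat (x 0) |>.comp (tendsto_add_atTop_nat 1) |>.congr
      fun n => by simp
  have h3 := (hx.mul h1).add h2
  rw [mul_one, add_zero] at h3
  refine h3.congr' ?_
  filter_upwards [eventually_gt_atTop 0] with n hn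
  rw [Finset.sum_range_succ']
  push_cast
  have : (n : ℝ) ≠ 0 := by positivity
  field_simp

end CesaroTendsto

/-- If `z (t + 1) = (1 - c / t) z t + ε t` with `c ≥ 0` and `ε t → 0`, then `z t / t → 0`. -/
theorem tendsto_div_of_recursion_of_tendsto_zero {z ε : ℕ → ℝ} {c : ℝ} (hc : 0 ≤ c)
    (hz : ∀ᶠ t : ℕ in atTop, z (t + 1) = (1 - c / t) * z t + ε t)
    (hε : Tendsto ε atTop (nhds 0)) : Tendsto (fun t : ℕ => z t / t) atTop (nhds 0) := by
  have hev : ∀ᶠ t : ℕ in atTop, |z (t + 1)| - |z t| ≤ |ε t| := by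
    filter_upwards [hz, eventually_ge_atTop (⌈c⌉₊ + 1)] with t ht htc
    have h1 : c ≤ t := (Nat.le_ceil c).trans (by exact_mod_cast (by omega : ⌈c⌉₊ ≤ t))
    have h2 : 0 < (t : ℝ) := by
      have : 0 < t := by omega
      positivity
    have h3 : c / t ≤ 1 := (div_le_one h2).2 h1
    have h4 : 0 ≤ c / t := by positivity
    rw [ht]
    have h5 := abs_add_le ((1 - c / t) * z t) (ε t)
    rw [abs_mul, abs_of_nonneg (by linarith : 0 ≤ 1 - c / t)] at h5
    have : (1 - c / t) * |z t| ≤ |z t| := mul_le_of_le_one_left (abs_nonneg _) (by linarith)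
    linarith
  obtain ⟨T, hT⟩ := eventually_atTop.1 hev
  have hb : ∀ t ≥ T, |z t| ≤ |z T| + ∑ s ∈ Finset.range t, |ε s| := by
    intro t ht
    induction t, ht using Nat.le_induction with
    | base => linarith [Finset.sum_nonneg fun s (_ : s ∈ Finset.range T) => abs_nonneg (ε s)]
    | succ t ht ih =>
      rw [Finset.sum_range_succ]
      linarith [hT t ht]
  have hces : CesaroTendsto (fun s => |ε s|) 0 :=
    CesaroTendsto.of_tendsto (by simpa using hε.abs)
  have hlim := (tendsto_const_div_atTop_nhds_zero_nat |z T|).add hces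
  rw [add_zero] at hlim
  refine squeeze_zero_norm' ?_ hlim
  filter_upwards [eventually_ge_atTop T] with t ht
  rw [Real.norm_eq_abs, abs_div, Nat.abs_cast, ← add_div]
  exact div_le_div_of_nonneg_right (hb t ht) (by positivity)

/-- If `x (t + 1) = (1 - c / t) x t + η t` with `c ≥ 0` and `η` has averages tending to `g`, then
`x t / t → g / (1 + c)`.  The sequence `η` need not converge: only its partial sums enter, through
the summed recursion `y t + c * ∑ s < t, y s / s = ∑ s < t, (η s - g)` for the deviation
`y t = x t - t * g / (1 + c)`, which turns into a recursion for `∑ s < t, y s / s` whose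
perturbation tends to zero. -/
theorem tendsto_div_of_recursion {x η : ℕ → ℝ} {c g : ℝ} (hc : 0 ≤ c)
    (hx : ∀ᶠ t : ℕ in atTop, x (t + 1) = (1 - c / t) * x t + η t)
    (hη : CesaroTendsto η g) : Tendsto (fun t : ℕ => x t / t) atTop (nhds (g / (1 + c))) := by
  set y : ℕ → ℝ := fun t => x t - t * (g / (1 + c)) with hy
  set z : ℕ → ℝ := fun t => ∑ s ∈ Finset.range t, y s / s with hzdef
  set S : ℕ → ℝ := fun t => ∑ s ∈ Finset.range t, (η s - g) with hS
  have hc1 : 1 + c ≠ 0 := by positivity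
  obtain ⟨T, hT⟩ := eventually_atTop.1 (hx.and (eventually_gt_atTop 0))
  have hstep : ∀ t ≥ T, y (t + 1) = y t - c * (y t / t) + (η t - g) := by
    intro t ht
    obtain ⟨h1, h2⟩ := hT t ht
    have h2' : (t : ℝ) ≠ 0 := by positivity
    simp only [hy]
    rw [h1]
    push_cast
    field_simp
    ring
  -- the constant `K` absorbs the finitely many times before the recursion starts
  obtain ⟨K, hK⟩ : ∃ K, ∀ t ≥ T, y t = S t + K - c * z t := by
    refine ⟨y T - S T + c * z T, fun t ht => ?_⟩
    induction t, ht using Nat.le_induction with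
    | base => ring
    | succ t ht ih =>
      rw [hstep t ht]
      simp only [hzdef, hS, Finset.sum_range_succ]
      simp only [hzdef, hS] at ih
      linear_combination ih
  have hSK : Tendsto (fun t : ℕ => (S t + K) / t) atTop (nhds 0) := by
    have h1 : CesaroTendsto (fun t => η t - g) (g - g) :=
      hη.sub (CesaroTendsto.of_tendsto tendsto_const_nhds)
    rw [sub_self] at h1
    simpa only [add_div, add_zero] using Tendsto.add h1 (tendsto_const_div_atTop_nhds_zero_nat K)
  have hz : Tendsto (fun t : ℕ => z t / t) atTop (nhds 0) := by
    refine tendsto_div_of_recursion_of_tendsto_zero hc ?_ hSK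
    filter_upwards [eventually_ge_atTop T] with t ht
    have : z (t + 1) = z t + y t / t := by simp only [hzdef, Finset.sum_range_succ]
    rw [this, hK t ht]
    ring
  have hfin := (hSK.sub (hz.const_mul c)).add_const (g / (1 + c))
  simp only [mul_zero, sub_zero, zero_add] at hfin
  refine hfin.congr' ?_
  filter_upwards [eventually_ge_atTop T] with t ht
  have h2 := (hT t ht).2
  have h2' : (t : ℝ) ≠ 0 := by positivity
  have h3 : S t + K = y t + c * z t := by rw [hK t ht]; ring
  rw [h3]
  simp only [hy]
  field_simp
  ring

/-! ### A strong law for bounded orthogonal variables -/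

/-- Bounded, pairwise orthogonal random variables have averages tending to zero almost surely: the
second moments of the averages are summable along the squares, and bounded increments fill the
gaps between consecutive squares. -/
theorem ae_cesaroTendsto_zero_of_orthogonal {Ω : Type*} [MeasurableSpace Ω] {μ : Measure Ω}
    [IsProbabilityMeasure μ] {X : ℕ → Ω → ℝ} {C : ℝ} (hm : ∀ n, Measurable (X n))
    (hb : ∀ n, ∀ᵐ ω ∂μ, |X n ω| ≤ C) (ho : ∀ m n, m < n → ∫ ω, X m ω * X n ω ∂μ = 0) :
    ∀ᵐ ω ∂μ, CesaroTendsto (fun n => X n ω) 0 := by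
  have hC : 0 ≤ C := by
    obtain ⟨ω, hω⟩ := (hb 0).exists
    exact (abs_nonneg _).trans hω
  have hint : ∀ m n, Integrable (fun ω => X m ω * X n ω) μ := by
    intro m n
    refine Integrable.of_bound ((hm m).mul (hm n)).aestronglyMeasurable (C * C) ?_
    filter_upwards [hb m, hb n] with ω h1 h2
    rw [Real.norm_eq_abs, abs_mul]
    exact mul_le_mul h1 h2 (abs_nonneg _) hC
  have hsq : ∀ n, ∫ ω, X n ω * X n ω ∂μ ≤ C * C := by
    intro n
    calc ∫ ω, X n ω * X n ω ∂μ ≤ ∫ _, C * C ∂μ := by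
          refine integral_mono_ae (hint n n) (integrable_const _) ?_
          filter_upwards [hb n] with ω h1
          rw [← abs_mul_abs_self]
          exact mul_le_mul h1 h1 (abs_nonneg _) hC
      _ = C * C := by simp
  set S : ℕ → Ω → ℝ := fun n ω => ∑ i ∈ Finset.range n, X i ω with hS
  have hSm : ∀ n, Measurable (S n) := fun n => Finset.measurable_fun_sum _ fun i _ => hm i
  have hSexp : ∀ n ω, S n ω ^ 2 =
      ∑ i ∈ Finset.range n, ∑ j ∈ Finset.range n, X i ω * X j ω := by
    intro n ω
    rw [sq, hS, Finset.sum_mul_sum]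
  have hSint : ∀ n, Integrable (fun ω => S n ω ^ 2) μ := by
    intro n
    simp only [hSexp]
    exact integrable_finsetSum _ fun i _ => integrable_finsetSum _ fun j _ => hint i j
  have hvar : ∀ n, ∫ ω, S n ω ^ 2 ∂μ ≤ n * (C * C) := by
    intro n
    simp only [hSexp]
    rw [integral_finsetSum _ fun i _ => integrable_finsetSum _ fun j _ => hint i j]
    calc ∑ i ∈ Finset.range n, ∫ ω, ∑ j ∈ Finset.range n, X i ω * X j ω ∂μ
        ≤ ∑ i ∈ Finset.range n, C * C := by
          refine Finset.sum_le_sum fun i hi => ?_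
          rw [integral_finsetSum _ fun j _ => hint i j, Finset.sum_eq_single i]
          · exact hsq i
          · intro j _ hji
            rcases lt_or_gt_of_ne hji with h | h
            · simpa only [mul_comm] using ho j i h
            · exact ho i j h
          · exact fun h => absurd hi h
      _ = n * (C * C) := by simp
  -- summability along the squares
  have hsum : ∑' m : ℕ, ∫⁻ ω, ENNReal.ofReal ((S (m ^ 2) ω / (m : ℝ) ^ 2) ^ 2) ∂μ ≠ ⊤ := by
    have hle : ∀ m : ℕ, ∫⁻ ω, ENNReal.ofReal ((S (m ^ 2) ω / (m : ℝ) ^ 2) ^ 2) ∂μ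
        ≤ ENNReal.ofReal (C * C * (1 / (m : ℝ) ^ 2)) := by
      intro m
      simp only [div_pow]
      rw [← ofReal_integral_eq_lintegral_ofReal ((hSint _).div_const _)
        (ae_of_all _ fun ω => by positivity), integral_div]
      apply ENNReal.ofReal_le_ofReal
      rcases Nat.eq_zero_or_pos m with rfl | hm0
      · simp
      · rw [div_le_iff₀ (by positivity)]
        refine (hvar _).trans (le_of_eq ?_)
        push_cast
        field_simp
    refine ne_top_of_le_ne_top ?_ (ENNReal.tsum_le_tsum hle)
    have hs : Summable fun m : ℕ => C * C * (1 / (m : ℝ) ^ 2) :=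
      (Real.summable_one_div_nat_pow.2 (by norm_num)).mul_left _
    exact hs.tsum_ofReal_ne_top
  rw [← lintegral_tsum fun m => ((((hSm _).div_const _).pow_const 2).ennreal_ofReal).aemeasurable]
    at hsum
  have hae := ae_lt_top' (AEMeasurable.tsum fun m =>
    ((((hSm _).div_const _).pow_const 2).ennreal_ofReal).aemeasurable) hsum
  filter_upwards [hae, ae_all_iff.2 hb] with ω hω hbω
  have h0 : Tendsto (fun m : ℕ => (S (m ^ 2) ω / (m : ℝ) ^ 2) ^ 2) atTop (nhds 0) := by
    have h1 := ENNReal.tendsto_atTop_zero_of_tsum_ne_top hω.ne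
    have h2 := (ENNReal.tendsto_toReal ENNReal.zero_ne_top).comp h1
    simp only [ENNReal.toReal_zero] at h2
    refine h2.congr fun m => ?_
    exact ENNReal.toReal_ofReal (by positivity)
  have h1 : Tendsto (fun m : ℕ => |S (m ^ 2) ω / (m : ℝ) ^ 2|) atTop (nhds 0) := by
    have := h0.sqrt
    simpa [Real.sqrt_sq_eq_abs] using this
  have hsqrt : Tendsto Nat.sqrt atTop atTop := by
    refine tendsto_atTop.2 fun b => ?_
    filter_upwards [eventually_ge_atTop (b * b)] with n hn
    exact Nat.le_sqrt.2 hn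
  have h2 : Tendsto (fun m : ℕ => |S (m ^ 2) ω / (m : ℝ) ^ 2| + 2 * C / m) atTop (nhds 0) := by
    simpa using h1.add (tendsto_const_div_atTop_nhds_zero_nat (2 * C))
  refine squeeze_zero_norm' ?_ (h2.comp hsqrt)
  filter_upwards [eventually_gt_atTop 0] with n hn
  set m := Nat.sqrt n with hmdef
  have hm0 : 0 < m := Nat.sqrt_pos.2 hn
  have hmn : m ^ 2 ≤ n := Nat.sqrt_le' n
  have hnm : n ≤ m * m + m + m := Nat.sqrt_le_add n
  have hdiff : |S n ω| ≤ |S (m ^ 2) ω| + 2 * m * C := by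
    have h3 : S n ω = S (m ^ 2) ω + ∑ i ∈ Finset.Ico (m ^ 2) n, X i ω := by
      simp only [hS]
      rw [Finset.sum_range_add_sum_Ico _ hmn]
    have h4 : |∑ i ∈ Finset.Ico (m ^ 2) n, X i ω| ≤ 2 * m * C := by
      calc |∑ i ∈ Finset.Ico (m ^ 2) n, X i ω| ≤ ∑ i ∈ Finset.Ico (m ^ 2) n, |X i ω| :=
            Finset.abs_sum_le_sum_abs _ _
        _ ≤ ∑ i ∈ Finset.Ico (m ^ 2) n, C := Finset.sum_le_sum fun i _ => hbω i
        _ = ((n - m ^ 2 : ℕ) : ℝ) * C := by simp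
        _ ≤ 2 * m * C := by
          refine mul_le_mul_of_nonneg_right ?_ hC
          have h5 : n - m ^ 2 ≤ 2 * m := by rw [pow_two]; omega
          exact_mod_cast h5
    rw [h3]
    exact (abs_add_le _ _).trans (by linarith)
  have hm' : 0 < (m : ℝ) := by positivity
  have hmn' : (m : ℝ) ^ 2 ≤ n := by exact_mod_cast hmn
  simp only [Function.comp, Real.norm_eq_abs]
  rw [abs_div, Nat.abs_cast, abs_div, abs_of_pos (by positivity : 0 < (m : ℝ) ^ 2)]
  calc |∑ i ∈ Finset.range n, X i ω| / n ≤ (|S (m ^ 2) ω| + 2 * m * C) / n :=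
        div_le_div_of_nonneg_right hdiff (by positivity)
    _ ≤ (|S (m ^ 2) ω| + 2 * m * C) / (m : ℝ) ^ 2 :=
        div_le_div_of_nonneg_left (by positivity) (by positivity) hmn'
    _ = |S (m ^ 2) ω| / (m : ℝ) ^ 2 + 2 * C / m := by
        field_simp

/-! ### Innovations of the process -/

/-- Extension by zero of a finite attachment history. -/
def extendPast {t : ℕ} (b : Fin (t + 1) → Fin (t + 1)) (i : ℕ) : ℕ :=
  if h : i < t + 1 then b ⟨i, h⟩ else 0

/-- The difference between the value of `F a` at the vertex to which `v_{t+1}` attaches and its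
conditional expectation given the attachments up to time `t`. -/
noncomputable def innovation (l : ℕ) (p : ℝ) (F : (ℕ → ℕ) → ℕ → ℝ) (t : ℕ) (a : ℕ → ℕ) : ℝ :=
  F a (a (t + 1)) - ∑ j ∈ Finset.range (t + 1), treeAttachProb l p a t j * F a j

theorem upaGraph_congr {a b : ℕ → ℕ} {t : ℕ} (h : ∀ i ∈ Set.Iic t, a i = b i) :
    upaGraph a t = upaGraph b t := by
  ext i k
  rw [upaGraph_adj, upaGraph_adj, h i (Set.mem_Iic.2 (by omega)),
    h k (Set.mem_Iic.2 (by omega))]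

theorem upaDegree_congr {a b : ℕ → ℕ} {t : ℕ} (h : ∀ i ∈ Set.Iic t, a i = b i)
    (j : Fin (t + 1)) : upaDegree a t j = upaDegree b t j := by
  rw [upaDegree, upaDegree, upaGraph_congr h]

theorem upaAttachProb_dependsOn (l : ℕ) (p : ℝ) (t : ℕ) (j : Fin (t + 1)) :
    DependsOn (fun a => upaAttachProb l p a t j) (Set.Iic t) := by
  intro a b h
  simp only [upaAttachProb, upaDegree_congr h]

theorem treeAttachProb_dependsOn (l : ℕ) (p : ℝ) (t j : ℕ) :
    DependsOn (fun a => treeAttachProb l p a t j) (Set.Iic t) :=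
  fun _ _ h => treeAttachProb_congr (fun i hi => h i hi) j

theorem innovation_dependsOn {l : ℕ} {p : ℝ} {F : (ℕ → ℕ) → ℕ → ℝ} {t : ℕ}
    (hF : ∀ j, DependsOn (fun a => F a j) (Set.Iic t)) :
    DependsOn (innovation l p F t) (Set.Iic (t + 1)) := by
  intro a b h
  have h' : ∀ i ∈ Set.Iic t, a i = b i := fun i hi => h i (Set.Iic_subset_Iic.2 t.le_succ hi)
  unfold innovation
  rw [h (t + 1) Set.self_mem_Iic]
  congr 1
  · exact hF _ h'
  · exact Finset.sum_congr rfl fun j _ =>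
      congrArg₂ _ (treeAttachProb_dependsOn l p t j h') (hF j h')

section

variable {Ω : Type*} [MeasurableSpace Ω] {μ : Measure Ω} {Y : ℕ → Ω → ℕ}

theorem measurable_of_dependsOn (hY : ∀ i, Measurable (Y i)) {t : ℕ} {G : (ℕ → ℕ) → ℝ}
    (hG : DependsOn G (Set.Iic t)) : Measurable fun ω => G fun i => Y i ω := by
  have h1 : Measurable fun ω => fun i : Fin (t + 1) => Y i ω := measurable_pi_lambda _ fun i => hY i
  have h2 : Measurable fun b : Fin (t + 1) → ℕ =>
      G fun i => if h : i < t + 1 then b ⟨i, h⟩ else 0 := measurable_of_countable _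
  convert h2.comp h1 using 2 with ω
  refine hG fun i hi => ?_
  have : i < t + 1 := Nat.lt_succ_of_le hi
  simp [this]

theorem measurableSet_past (hY : ∀ i, Measurable (Y i)) (t : ℕ) (a : ℕ → ℕ) :
    MeasurableSet {ω | ∀ i ≤ t, Y i ω = a i} := by
  have : {ω | ∀ i ≤ t, Y i ω = a i} = ⋂ i, ⋂ (_ : i ≤ t), Y i ⁻¹' {a i} := by
    ext ω
    simp
  rw [this]
  exact MeasurableSet.iInter fun i => MeasurableSet.iInter fun _ =>
    hY i (measurableSet_singleton _)

/-- A function of a history that almost surely takes finitely many values is a simple function. -/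
theorem indicator_past_ae_eq {t : ℕ} (hle : ∀ᵐ ω ∂μ, ∀ i ≤ t, Y i ω ≤ t) {G : (ℕ → ℕ) → ℝ}
    (hG : DependsOn G (Set.Iic t)) (A : Set Ω) :
    A.indicator (fun ω => G fun i => Y i ω) =ᵐ[μ] fun ω =>
      ∑ b : Fin (t + 1) → Fin (t + 1),
        ({ω | ∀ i ≤ t, Y i ω = extendPast b i} ∩ A).indicator (fun _ => G (extendPast b)) ω := by
  filter_upwards [hle] with ω hω
  set b₀ : Fin (t + 1) → Fin (t + 1) :=
    fun i => ⟨Y i ω, Nat.lt_succ_of_le (hω i (Nat.le_of_lt_succ i.isLt))⟩ with hb₀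
  have h0 : ∀ i ≤ t, Y i ω = extendPast b₀ i := by
    intro i hi
    simp [extendPast, hb₀, Nat.lt_succ_of_le hi]
  rw [Finset.sum_eq_single b₀]
  · by_cases hA : ω ∈ A
    · have hmem : ω ∈ {ω | ∀ i ≤ t, Y i ω = extendPast b₀ i} ∩ A := ⟨h0, hA⟩
      rw [Set.indicator_of_mem hA, Set.indicator_of_mem hmem]
      exact hG h0
    · rw [Set.indicator_of_notMem hA, Set.indicator_of_notMem fun h => hA h.2]
  · intro b _ hb
    refine Set.indicator_of_notMem (fun h => hb ?_) _
    funext i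
    apply Fin.ext
    have h1 := h.1 i (Nat.le_of_lt_succ i.isLt)
    rw [extendPast, dif_pos i.isLt] at h1
    exact h1.symm
  · exact fun h => absurd (Finset.mem_univ _) h

variable [IsProbabilityMeasure μ]

theorem integrable_of_dependsOn (hY : ∀ i, Measurable (Y i)) {t : ℕ}
    (hle : ∀ᵐ ω ∂μ, ∀ i ≤ t, Y i ω ≤ t) {G : (ℕ → ℕ) → ℝ} (hG : DependsOn G (Set.Iic t)) :
    Integrable (fun ω => G fun i => Y i ω) μ := by
  have h := indicator_past_ae_eq hle hG Set.univ
  rw [Set.indicator_univ] at h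
  refine Integrable.congr ?_ h.symm
  exact integrable_finsetSum _ fun b _ => (integrable_const _).indicator
    ((measurableSet_past hY t _).inter MeasurableSet.univ)

theorem setIntegral_past (hY : ∀ i, Measurable (Y i)) {t : ℕ}
    (hle : ∀ᵐ ω ∂μ, ∀ i ≤ t, Y i ω ≤ t) {G : (ℕ → ℕ) → ℝ} (hG : DependsOn G (Set.Iic t))
    {A : Set Ω} (hA : MeasurableSet A) :
    ∫ ω in A, G (fun i => Y i ω) ∂μ = ∑ b : Fin (t + 1) → Fin (t + 1),
      μ.real ({ω | ∀ i ≤ t, Y i ω = extendPast b i} ∩ A) * G (extendPast b) := by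
  have hm := fun b : Fin (t + 1) → Fin (t + 1) => (measurableSet_past hY t (extendPast b)).inter hA
  rw [← integral_indicator hA, integral_congr_ae (indicator_past_ae_eq hle hG A),
    integral_finsetSum _ fun b _ => (integrable_const _).indicator (hm b)]
  exact Finset.sum_congr rfl fun b _ => by rw [integral_indicator_const _ (hm b), smul_eq_mul]

namespace IsUPAProcess

variable {l : ℕ} {p : ℝ}

theorem setIntegral_step_of_le (h : IsUPAProcess l p μ Y) {t : ℕ} (hlt : l ≤ t)
    (hle : ∀ᵐ ω ∂μ, ∀ i ≤ t, Y i ω ≤ t) {G : (ℕ → ℕ) → ℝ} (hG : DependsOn G (Set.Iic t))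
    (j : Fin (t + 1)) :
    ∫ ω in {ω | Y (t + 1) ω = j}, G (fun i => Y i ω) ∂μ
      = ∫ ω, upaAttachProb l p (fun i => Y i ω) t j * G (fun i => Y i ω) ∂μ := by
  have hG' : DependsOn (fun a => upaAttachProb l p a t j * G a) (Set.Iic t) :=
    fun a b hab => congrArg₂ _ (upaAttachProb_dependsOn l p t j hab) (hG hab)
  have hA : MeasurableSet {ω | Y (t + 1) ω = j} :=
    h.measurable (t + 1) (measurableSet_singleton _)
  have h2 := setIntegral_past h.measurable hle hG' MeasurableSet.univ
  rw [setIntegral_univ] at h2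
  rw [h2, setIntegral_past h.measurable hle hG hA]
  refine Finset.sum_congr rfl fun b _ => ?_
  rw [Set.inter_univ]
  have h3 : μ.real ({ω | ∀ i ≤ t, Y i ω = extendPast b i} ∩ {ω | Y (t + 1) ω = j})
      = upaAttachProb l p (extendPast b) t j * μ.real {ω | ∀ i ≤ t, Y i ω = extendPast b i} :=
    h.step t hlt (extendPast b) j
  rw [h3]
  ring

/-- Almost surely every vertex attaches to an earlier one: the attachment probabilities to the
existing vertices sum to one. -/
theorem ae_lt (h : IsUPAProcess l p μ Y) (hl : 1 ≤ l) : ∀ᵐ ω ∂μ, ∀ i, 1 ≤ i → Y i ω < i := by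
  suffices H : ∀ t, ∀ᵐ ω ∂μ, ∀ i, 1 ≤ i → i ≤ t → Y i ω < i by
    filter_upwards [ae_all_iff.2 H] with ω hω i hi
    exact hω i i hi le_rfl
  intro t
  induction t with
  | zero => exact ae_of_all _ fun ω i h1 h2 => by omega
  | succ t ih =>
    suffices hs : ∀ᵐ ω ∂μ, Y (t + 1) ω < t + 1 by
      filter_upwards [ih, hs] with ω h1 h2 i hi hit
      rcases Nat.lt_or_ge t i with h3 | h3
      · obtain rfl : i = t + 1 := by omega
        exact h2
      · exact h1 i hi h3
    rcases Nat.lt_or_ge t l with htl | hlt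
    · exact ae_of_all _ fun ω => by rw [h.init _ htl]; omega
    · have hle : ∀ᵐ ω ∂μ, ∀ i ≤ t, Y i ω ≤ t := by
        filter_upwards [ih] with ω h1 i hi
        rcases Nat.eq_zero_or_pos i with rfl | hi0
        · rw [h.init 0 (by omega)]; omega
        · have := h1 i hi0 hi
          omega
      have hG : DependsOn (fun _ : ℕ → ℕ => (1 : ℝ)) (Set.Iic t) := fun _ _ _ => rfl
      have hmeas : MeasurableSet {ω | Y (t + 1) ω < t + 1} :=
        h.measurable (t + 1) (measurableSet_Iio (a := t + 1))
      have hU : {ω | Y (t + 1) ω < t + 1} = ⋃ j : Fin (t + 1), {ω | Y (t + 1) ω = j} := by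
        ext ω
        simp only [Set.mem_ofPred_eq, Set.mem_iUnion]
        exact ⟨fun h => ⟨⟨_, h⟩, rfl⟩, fun ⟨j, hj⟩ => hj ▸ j.isLt⟩
      have h1 : μ.real {ω | Y (t + 1) ω < t + 1} = 1 := by
        rw [hU, measureReal_iUnion_fintype]
        · have hj : ∀ j : Fin (t + 1), μ.real {ω | Y (t + 1) ω = j}
              = ∫ ω, upaAttachProb l p (fun i => Y i ω) t j ∂μ := by
            intro j
            have := h.setIntegral_step_of_le hlt hle hG j
            simpa using this
          simp only [hj]
          rw [← integral_finsetSum _ fun j _ =>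
            integrable_of_dependsOn h.measurable hle (upaAttachProb_dependsOn l p t j)]
          calc ∫ ω, ∑ j : Fin (t + 1), upaAttachProb l p (fun i => Y i ω) t j ∂μ
              = ∫ _, (1 : ℝ) ∂μ := by
                refine integral_congr_ae ?_
                filter_upwards [ih] with ω hω
                simp only [upaAttachProb_eq hω]
                rw [Fin.sum_univ_eq_sum_range (fun j => treeAttachProb l p (fun i => Y i ω) t j)]
                exact sum_treeAttachProb hl hlt hω
            _ = 1 := by simp
        · intro i j hij
          refine Set.disjoint_left.2 fun ω h1 h2 => hij (Fin.ext ?_)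
          exact h1.symm.trans h2
        · exact fun j => h.measurable (t + 1) (measurableSet_singleton _)
      have h2 : μ {ω | Y (t + 1) ω < t + 1} = 1 := by
        rwa [measureReal_def, ENNReal.toReal_eq_one_iff] at h1
      exact (mem_ae_iff_prob_eq_one hmeas).2 h2

theorem ae_le (h : IsUPAProcess l p μ Y) (hl : 1 ≤ l) (t : ℕ) :
    ∀ᵐ ω ∂μ, ∀ i ≤ t, Y i ω ≤ t := by
  filter_upwards [h.ae_lt hl] with ω h1 i hi
  rcases Nat.eq_zero_or_pos i with rfl | hi0
  · rw [h.init 0 (by omega)]; omega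
  · have := h1 i hi0
    omega

theorem setIntegral_step (h : IsUPAProcess l p μ Y) (hl : 1 ≤ l) {t : ℕ} (hlt : l ≤ t)
    {G : (ℕ → ℕ) → ℝ} (hG : DependsOn G (Set.Iic t)) {j : ℕ} (hj : j ∈ Finset.range (t + 1)) :
    ∫ ω in {ω | Y (t + 1) ω = j}, G (fun i => Y i ω) ∂μ
      = ∫ ω, treeAttachProb l p (fun i => Y i ω) t j * G (fun i => Y i ω) ∂μ := by
  rw [h.setIntegral_step_of_le hlt (h.ae_le hl t) hG ⟨j, Finset.mem_range.1 hj⟩]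
  refine integral_congr_ae ?_
  filter_upwards [h.ae_lt hl] with ω hω
  rw [upaAttachProb_eq fun i hi _ => hω i hi]

/-- Innovations are orthogonal to the past. -/
theorem integral_mul_innovation (h : IsUPAProcess l p μ Y) (hl : 1 ≤ l) {t : ℕ} (hlt : l ≤ t)
    {G : (ℕ → ℕ) → ℝ} (hG : DependsOn G (Set.Iic t)) {F : (ℕ → ℕ) → ℕ → ℝ}
    (hF : ∀ j, DependsOn (fun a => F a j) (Set.Iic t)) :
    ∫ ω, G (fun i => Y i ω) * innovation l p F t (fun i => Y i ω) ∂μ = 0 := by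
  have hGF : ∀ j, DependsOn (fun a => G a * F a j) (Set.Iic t) :=
    fun j a b hab => congrArg₂ _ (hG hab) (hF j hab)
  have hAGF : ∀ j, DependsOn (fun a => treeAttachProb l p a t j * (G a * F a j)) (Set.Iic t) :=
    fun j a b hab => congrArg₂ _ (treeAttachProb_dependsOn l p t j hab) (hGF j hab)
  have hms : ∀ j, MeasurableSet {ω | Y (t + 1) ω = j} :=
    fun j => h.measurable (t + 1) (measurableSet_singleton _)
  have hi1 := fun j => (integrable_of_dependsOn h.measurable (h.ae_le hl t) (hGF j)).indicator
    (hms j)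
  have hi2 := fun j => integrable_of_dependsOn h.measurable (h.ae_le hl t) (hAGF j)
  calc ∫ ω, G (fun i => Y i ω) * innovation l p F t (fun i => Y i ω) ∂μ
      = ∫ ω, ((∑ j ∈ Finset.range (t + 1), {ω | Y (t + 1) ω = j}.indicator
            (fun ω => G (fun i => Y i ω) * F (fun i => Y i ω) j) ω)
          - ∑ j ∈ Finset.range (t + 1), treeAttachProb l p (fun i => Y i ω) t j
              * (G (fun i => Y i ω) * F (fun i => Y i ω) j)) ∂μ := by
        refine integral_congr_ae ?_
        filter_upwards [h.ae_lt hl] with ω hω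
        simp only [innovation, mul_sub]
        congr 1
        · rw [Finset.sum_eq_single (Y (t + 1) ω)]
          · rw [Set.indicator_of_mem (by simp)]
          · intro j _ hj
            exact Set.indicator_of_notMem (fun h' => hj h'.symm) _
          · intro h'
            exact absurd (Finset.mem_range.2 (hω (t + 1) (by omega))) h'
        · rw [Finset.mul_sum]
          exact Finset.sum_congr rfl fun j _ => by ring
    _ = 0 := by
        rw [integral_sub (integrable_finsetSum _ fun j _ => hi1 j)
          (integrable_finsetSum _ fun j _ => hi2 j), integral_finsetSum _ fun j _ => hi1 j,
          integral_finsetSum _ fun j _ => hi2 j, sub_eq_zero]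
        refine Finset.sum_congr rfl fun j hj => ?_
        rw [integral_indicator (hms j)]
        exact h.setIntegral_step hl hlt (hGF j) hj

/-- The innovations of bounded functionals average to zero along almost every path. -/
theorem ae_cesaroTendsto_innovation (h : IsUPAProcess l p μ Y) (hl : 1 ≤ l) (hp0 : 0 ≤ p)
    (hp1 : p ≤ 1) {F : ℕ → (ℕ → ℕ) → ℕ → ℝ}
    (hF : ∀ t j, DependsOn (fun a => F t a j) (Set.Iic t)) (hF1 : ∀ t a j, |F t a j| ≤ 1) :
    ∀ᵐ ω ∂μ, CesaroTendsto (fun t => innovation l p (F t) t fun i => Y i ω) 0 := by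
  set X : ℕ → (ℕ → ℕ) → ℝ := fun t a => if l ≤ t then innovation l p (F t) t a else 0 with hX
  have hXd : ∀ t, DependsOn (X t) (Set.Iic (t + 1)) := by
    intro t a b hab
    simp only [hX]
    split_ifs
    · exact innovation_dependsOn (hF t) hab
    · rfl
  have hXb : ∀ t, ∀ᵐ ω ∂μ, |X t fun i => Y i ω| ≤ 2 := by
    intro t
    filter_upwards [h.ae_lt hl] with ω hω
    simp only [hX]
    split_ifs with hlt
    · unfold innovation
      have h1 : |∑ j ∈ Finset.range (t + 1),
          treeAttachProb l p (fun i => Y i ω) t j * F t (fun i => Y i ω) j| ≤ 1 := by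
        rw [← sum_treeAttachProb (p := p) hl hlt fun i hi _ => hω i hi]
        refine (Finset.abs_sum_le_sum_abs _ _).trans (Finset.sum_le_sum fun j _ => ?_)
        have h2 := treeAttachProb_nonneg (l := l) hp0 hp1 (fun i => Y i ω) t j
        rw [abs_mul, abs_of_nonneg h2]
        exact mul_le_of_le_one_right h2 (hF1 _ _ _)
      have h2 := hF1 t (fun i => Y i ω) (Y (t + 1) ω)
      exact (abs_sub _ _).trans (by linarith)
    · simp
  have hXo : ∀ m n, m < n →
      ∫ ω, (X m fun i => Y i ω) * (X n fun i => Y i ω) ∂μ = 0 := by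
    intro m n hmn
    by_cases hln : l ≤ n
    · simp only [hX, if_pos hln]
      refine h.integral_mul_innovation hl hln (G := X m) ?_ (hF n)
      exact fun a b hab => hXd m fun i hi => hab i (Set.Iic_subset_Iic.2 hmn hi)
    · simp [hX, hln]
  have hmain := ae_cesaroTendsto_zero_of_orthogonal
    (fun t => measurable_of_dependsOn h.measurable (hXd t)) hXb hXo
  filter_upwards [hmain] with ω hω
  refine hω.congr ?_
  filter_upwards [eventually_ge_atTop l] with t ht
  simp [hX, ht]

end IsUPAProcess

end

/-! ### Degrees in the window -/

/-- The indicator of the event that `v_j` has degree `k` at time `t`. -/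
def hasDegree (k t : ℕ) (a : ℕ → ℕ) (j : ℕ) : ℝ := if treeDegree a t j = k then 1 else 0

/-- The increment of the indicator of degree `k + 1` at a vertex that receives an edge. -/
def degreeGain (k t : ℕ) (a : ℕ → ℕ) (j : ℕ) : ℝ := hasDegree k t a j - hasDegree (k + 1) t a j

theorem hasDegree_dependsOn (k t j : ℕ) :
    DependsOn (fun a => hasDegree k t a j) (Set.Iic t) := by
  intro a b h
  simp only [hasDegree, treeDegree_congr fun i hi => h i hi]

theorem degreeGain_dependsOn (k t j : ℕ) :
    DependsOn (fun a => degreeGain k t a j) (Set.Iic t) :=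
  fun _ _ h =>
    congrArg₂ (· - ·) (hasDegree_dependsOn k t j h) (hasDegree_dependsOn (k + 1) t j h)

theorem abs_degreeGain_le (k t : ℕ) (a : ℕ → ℕ) (j : ℕ) : |degreeGain k t a j| ≤ 1 := by
  unfold degreeGain hasDegree
  split_ifs <;> simp

theorem hasDegree_succ (k t : ℕ) (a : ℕ → ℕ) (j : ℕ) :
    hasDegree (k + 1) (t + 1) a j
      = hasDegree (k + 1) t a j + if a (t + 1) = j then degreeGain k t a j else 0 := by
  simp only [hasDegree, degreeGain, treeDegree_succ]
  by_cases h : a (t + 1) = j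
  · simp [h]
  · simp [h]

theorem hasDegree_zero {t j : ℕ} (a : ℕ → ℕ) (hj : 0 < j) : hasDegree 0 t a j = 0 :=
  if_neg (treeDegree_pos a t hj).ne'

/-- The limiting frequency of degree `k` at a window vertex of age `i`: such a vertex has one
edge to its parent and a binomial number of further edges. -/
noncomputable def windowFreq (r : ℝ) : ℕ → ℕ → ℝ
  | _, 0 => 0
  | 0, k + 1 => if k = 0 then 1 else 0
  | i + 1, k + 1 => windowFreq r i (k + 1) + r * (windowFreq r i k - windowFreq r i (k + 1))

/-- The functional whose innovation governs a window vertex of age `i`. -/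
def windowGain (i k t : ℕ) (a : ℕ → ℕ) (j : ℕ) : ℝ :=
  if j = t - i then degreeGain k t a j else 0

theorem windowGain_dependsOn (i k t j : ℕ) :
    DependsOn (fun a => windowGain i k t a j) (Set.Iic t) := by
  intro a b h
  have := degreeGain_dependsOn k t j h
  simp only at this
  simp only [windowGain, this]

theorem abs_windowGain_le (i k t : ℕ) (a : ℕ → ℕ) (j : ℕ) : |windowGain i k t a j| ≤ 1 := by
  unfold windowGain
  split_ifs
  · exact abs_degreeGain_le k t a j
  · simp

/-- The exact one-step evolution of a window vertex: uniform attachment contributes at rate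
`p / l`, preferential attachment only at a rate of order `1 / t`. -/
theorem hasDegree_window_succ {l : ℕ} {p : ℝ} {a : ℕ → ℕ} {i t : ℕ} (hil : i < l) (hlt : l ≤ t)
    (k : ℕ) :
    hasDegree (k + 1) (t + 1) a (t - i) = hasDegree (k + 1) t a (t - i)
      + p / l * (hasDegree k t a (t - i) - hasDegree (k + 1) t a (t - i))
      + innovation l p (windowGain i k t) t a
      + (1 - p) * (treeDegree a t (t - i) / (2 * t)) * degreeGain k t a (t - i) := by
  have h1 : ∑ j ∈ Finset.range (t + 1), treeAttachProb l p a t j * windowGain i k t a j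
      = treeAttachProb l p a t (t - i) * degreeGain k t a (t - i) := by
    rw [Finset.sum_eq_single (t - i)]
    · simp [windowGain]
    · intro j _ hj
      simp [windowGain, hj]
    · intro h
      exact absurd (Finset.mem_range.2 (by omega)) h
  have h2 : windowGain i k t a (a (t + 1))
      = if a (t + 1) = t - i then degreeGain k t a (t - i) else 0 := by
    unfold windowGain
    split_ifs with h
    · rw [h]
    · rfl
  rw [hasDegree_succ, innovation, h1, h2, treeAttachProb, if_pos (by omega : t < t - i + l)]
  simp only [degreeGain]
  ring

/-- Averaged over time, the degrees of the window vertices of age `i` follow `windowFreq`,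
along every path on which the innovations average out. -/
theorem cesaroTendsto_hasDegree_window {l : ℕ} {p : ℝ} {a : ℕ → ℕ} (hp0 : 0 ≤ p) (hp1 : p ≤ 1)
    (ha : ∀ i, 1 ≤ i → a i < i)
    (hin : ∀ i k, CesaroTendsto (fun t => innovation l p (windowGain i k t) t a) 0) :
    ∀ i < l, ∀ k, CesaroTendsto (fun t => hasDegree k t a (t - i)) (windowFreq (p / l) i k) := by
  intro i
  induction i with
  | zero =>
    intro _ k
    refine CesaroTendsto.of_tendsto (tendsto_const_nhds.congr' ?_)
    filter_upwards [eventually_gt_atTop 0] with t ht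
    rw [Nat.sub_zero, hasDegree, treeDegree_last ha ht]
    cases k with
    | zero => simp [windowFreq]
    | succ k => simp [windowFreq]
  | succ i ih =>
    intro hil k
    cases k with
    | zero =>
      rw [windowFreq]
      refine CesaroTendsto.of_tendsto (tendsto_const_nhds.congr' ?_)
      filter_upwards [eventually_gt_atTop (i + 1)] with t ht
      exact (hasDegree_zero a (by omega)).symm
    | succ k =>
      have hi := ih (by omega)
      have hsmall : Tendsto (fun t : ℕ => (1 - p) * (treeDegree a t (t - i) / (2 * t))
          * degreeGain k t a (t - i)) atTop (nhds 0) := by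
        refine squeeze_zero_norm' ?_ (tendsto_const_div_atTop_nhds_zero_nat ((1 + i : ℕ) : ℝ))
        filter_upwards [eventually_gt_atTop i] with t ht
        have h1 : (treeDegree a t (t - i) : ℝ) ≤ (1 + i : ℕ) := by
          have := treeDegree_le ha t (t - i)
          exact_mod_cast this.trans (by omega)
        have h2 : 0 < (t : ℝ) := by
          have : 0 < t := by omega
          positivity
        have h3 : 0 ≤ 1 - p := by linarith
        have h4 : (treeDegree a t (t - i) : ℝ) / (2 * t) ≤ (1 + i : ℕ) / t :=
          div_le_div₀ (by positivity) h1 h2 (by linarith)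
        have h5 : 0 ≤ (treeDegree a t (t - i) : ℝ) / (2 * t) := by positivity
        rw [Real.norm_eq_abs, abs_mul, abs_of_nonneg (mul_nonneg h3 h5)]
        calc (1 - p) * ((treeDegree a t (t - i) : ℝ) / (2 * t)) * |degreeGain k t a (t - i)|
            ≤ (1 - p) * ((treeDegree a t (t - i) : ℝ) / (2 * t)) :=
              mul_le_of_le_one_right (mul_nonneg h3 h5) (abs_degreeGain_le _ _ _ _)
          _ ≤ (treeDegree a t (t - i) : ℝ) / (2 * t) := mul_le_of_le_one_left h5 (by linarith)
          _ ≤ _ := h4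
      have hsum := (((hi (k + 1)).add (((hi k).sub (hi (k + 1))).const_mul (p / l))).add
        (hin i k)).add (CesaroTendsto.of_tendsto hsmall)
      rw [add_zero, add_zero] at hsum
      rw [windowFreq]
      refine CesaroTendsto.of_succ (hsum.congr ?_)
      filter_upwards [eventually_ge_atTop l] with t ht
      rw [← hasDegree_window_succ (by omega) ht, Nat.add_sub_add_right]

/-! ### The degree counts -/

theorem upaCount_eq_sum {a : ℕ → ℕ} (ha : ∀ i, 1 ≤ i → a i < i) (k t : ℕ) :
    (upaCount a k t : ℝ) = ∑ j ∈ Finset.range (t + 1), hasDegree k t a j := by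
  classical
  simp only [upaCount, upaDegree_eq_treeDegree fun i hi _ => ha i hi, hasDegree]
  rw [← Fin.sum_univ_eq_sum_range (fun j => if treeDegree a t j = k then (1 : ℝ) else 0),
    Finset.sum_boole]

/-- The exact one-step evolution of the number of vertices of degree `k + 1`. -/
theorem upaCount_succ {l : ℕ} {p : ℝ} {a : ℕ → ℕ} (ha : ∀ i, 1 ≤ i → a i < i) (k : ℕ) {t : ℕ}
    (hlt : l ≤ t) :
    (upaCount a (k + 1) (t + 1) : ℝ)
      = (1 - (1 - p) * (k + 1) / 2 / t) * upaCount a (k + 1) t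
        + ((if k = 0 then 1 else 0)
          + p / l * ∑ i ∈ Finset.range l, (hasDegree k t a (t - i) - hasDegree (k + 1) t a (t - i))
          + (1 - p) * k / 2 * (upaCount a k t / t)
          + innovation l p (degreeGain k t) t a) := by
  have hw : ∑ j ∈ Finset.range (t + 1), (treeDegree a t j : ℝ) * degreeGain k t a j
      = k * upaCount a k t - (k + 1) * upaCount a (k + 1) t := by
    rw [upaCount_eq_sum ha, upaCount_eq_sum ha, Finset.mul_sum, Finset.mul_sum,
      ← Finset.sum_sub_distrib]
    refine Finset.sum_congr rfl fun j _ => ?_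
    have hk : ∀ m : ℕ, (treeDegree a t j : ℝ) * hasDegree m t a j = m * hasDegree m t a j := by
      intro m
      unfold hasDegree
      split_ifs with h
      · rw [h]
      · simp
    rw [degreeGain, mul_sub, hk, hk]
    push_cast
    ring
  have hnew : hasDegree (k + 1) (t + 1) a (t + 1) = if k = 0 then 1 else 0 := by
    rw [hasDegree, treeDegree_last ha (by omega)]
    simp
  have hold : ∑ j ∈ Finset.range (t + 1), (if a (t + 1) = j then degreeGain k t a j else 0)
      = degreeGain k t a (a (t + 1)) := by
    rw [Finset.sum_ite_eq, if_pos (Finset.mem_range.2 (ha (t + 1) (by omega)))]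
  have hinn := sum_treeAttachProb_mul (p := p) hlt a (degreeGain k t a)
  rw [hw] at hinn
  rw [innovation, hinn, upaCount_eq_sum ha (k + 1) (t + 1), Finset.sum_range_succ, hnew]
  simp only [hasDegree_succ, Finset.sum_add_distrib]
  rw [hold, ← upaCount_eq_sum ha]
  simp only [degreeGain]
  ring

/-- The limiting degree distribution, defined by the stationary form of `upaCount_succ`. -/
noncomputable def limitFreq (l : ℕ) (p : ℝ) : ℕ → ℝ
  | 0 => 0
  | k + 1 => ((if k = 0 then 1 else 0)
      + p / l * ∑ i ∈ Finset.range l, (windowFreq (p / l) i k - windowFreq (p / l) i (k + 1))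
      + (1 - p) * k / 2 * limitFreq l p k) / (1 + (1 - p) * (k + 1) / 2)

theorem tendsto_upaCount_div {l : ℕ} {p : ℝ} {a : ℕ → ℕ} (hp0 : 0 ≤ p) (hp1 : p ≤ 1)
    (ha : ∀ i, 1 ≤ i → a i < i)
    (hwin : ∀ i k, CesaroTendsto (fun t => innovation l p (windowGain i k t) t a) 0)
    (hdeg : ∀ k, CesaroTendsto (fun t => innovation l p (degreeGain k t) t a) 0) (k : ℕ) :
    Tendsto (fun t : ℕ => (upaCount a (k + 1) t : ℝ) / t) atTop
      (nhds (limitFreq l p (k + 1))) := by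
  have hp : 0 ≤ 1 - p := by linarith
  have hw := cesaroTendsto_hasDegree_window hp0 hp1 ha hwin
  have step : ∀ k : ℕ, Tendsto (fun t : ℕ => (1 - p) * k / 2 * ((upaCount a k t : ℝ) / t)) atTop
      (nhds ((1 - p) * k / 2 * limitFreq l p k)) →
      Tendsto (fun t : ℕ => (upaCount a (k + 1) t : ℝ) / t) atTop
        (nhds (limitFreq l p (k + 1))) := by
    intro k hk
    have h1 := CesaroTendsto.sum (Finset.range l) fun i hi =>
      (hw i (Finset.mem_range.1 hi) k).sub (hw i (Finset.mem_range.1 hi) (k + 1))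
    have h2 := (((CesaroTendsto.of_tendsto
      (tendsto_const_nhds (x := if k = 0 then (1 : ℝ) else 0))).add (h1.const_mul (p / l))).add
      (CesaroTendsto.of_tendsto hk)).add (hdeg k)
    rw [add_zero] at h2
    rw [limitFreq]
    refine tendsto_div_of_recursion (c := (1 - p) * (k + 1) / 2) (by positivity) ?_ h2
    filter_upwards [eventually_ge_atTop l] with t ht
    exact upaCount_succ ha k ht
  induction k with
  | zero => exact step 0 (by simp)
  | succ k ih => exact step (k + 1) (ih.const_mul _)

theorem IsUPAProcess.tendstoInMeasure {Ω : Type*} [MeasurableSpace Ω] {μ : Measure Ω}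
    [IsProbabilityMeasure μ] {Y : ℕ → Ω → ℕ} {l : ℕ} {p : ℝ} (h : IsUPAProcess l p μ Y)
    (hl : 1 ≤ l) (hp0 : 0 ≤ p) (hp1 : p ≤ 1) {k : ℕ} (hk : 1 ≤ k) :
    TendstoInMeasure μ (fun (t : ℕ) (ω : Ω) => (upaCount (fun i => Y i ω) k t : ℝ) / (t : ℝ))
      atTop (fun _ => limitFreq l p k) := by
  obtain ⟨k, rfl⟩ : ∃ m, k = m + 1 := ⟨k - 1, by omega⟩
  refine tendstoInMeasure_of_tendsto_ae (fun t => ?_) ?_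
  · -- only the values of the path up to time `t` matter for the graph at time `t`
    refine (measurable_of_dependsOn (t := t) h.measurable
      (G := fun a => (upaCount a (k + 1) t : ℝ) / t) ?_).aestronglyMeasurable
    intro a b hab
    simp only [upaCount, upaDegree_congr hab]
  · filter_upwards [h.ae_lt hl,
      ae_all_iff.2 fun i => ae_all_iff.2 fun k => h.ae_cesaroTendsto_innovation hl hp0 hp1
        (F := fun t => windowGain i k t) (windowGain_dependsOn i k) (abs_windowGain_le i k),
      ae_all_iff.2 fun k => h.ae_cesaroTendsto_innovation hl hp0 hp1
        (F := fun t => degreeGain k t) (degreeGain_dependsOn k) (abs_degreeGain_le k)]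
      with ω h1 h2 h3
    exact tendsto_upaCount_div hp0 hp1 h1 h2 h3 k

/-! ### Closed forms -/

theorem windowFreq_eq_choose (r : ℝ) (i k : ℕ) :
    windowFreq r i (k + 1) = r ^ k * ((i.choose k : ℝ) * (1 - r) ^ (i - k)) := by
  induction i generalizing k with
  | zero => cases k <;> simp [windowFreq]
  | succ i ih =>
    cases k with
    | zero =>
      simp only [windowFreq, ih]
      simp
      ring
    | succ k =>
      rw [windowFreq, ih, ih, Nat.choose_succ_succ, Nat.add_sub_add_right]
      rcases Nat.lt_or_ge k i with h | h
      · obtain ⟨m, rfl⟩ : ∃ m, i = k + 1 + m := ⟨i - (k + 1), by omega⟩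
        rw [show k + 1 + m - (k + 1) = m by omega, show k + 1 + m - k = m + 1 by omega]
        push_cast
        ring
      · rw [Nat.choose_eq_zero_of_lt (by omega : i < k + 1)]
        push_cast
        ring

theorem upaH_eq_sum_windowFreq (l : ℕ) (p : ℝ) (k : ℕ) :
    upaH l p k = ∑ i ∈ Finset.range l, windowFreq (p / l) i k := by
  unfold upaH
  split_ifs with h
  · obtain ⟨k, rfl⟩ : ∃ m, k = m + 1 := ⟨k - 1, by omega⟩
    simp only [windowFreq_eq_choose, Nat.add_sub_cancel]
    rw [← Finset.mul_sum]
    congr 1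
    -- ages below `k` contribute nothing; the other ages are `l - m` with `1 ≤ m ≤ l - k`
    have hsub : Finset.Ico k l ⊆ Finset.range l := fun i hi =>
      Finset.mem_range.2 (Finset.mem_Ico.1 hi).2
    rw [← Finset.sum_subset hsub]
    · refine Finset.sum_nbij' (fun m => l - m) (fun i => l - i) ?_ ?_ ?_ ?_ ?_ <;>
        simp only [Finset.mem_Icc, Finset.mem_Ico]
      any_goals intros; omega
      intro m hm
      rw [Nat.choose_symm (by omega)]
    · intro i hi hni
      simp only [Finset.mem_Ico, Finset.mem_range] at hi hni
      rw [Nat.choose_eq_zero_of_lt (by omega)]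
      simp
  · symm
    refine Finset.sum_eq_zero fun i hi => ?_
    rw [Finset.mem_range] at hi
    cases k with
    | zero => rw [windowFreq.eq_def]
    | succ k =>
      rw [windowFreq_eq_choose, Nat.choose_eq_zero_of_lt (by omega)]
      simp

theorem limitFreq_succ {l : ℕ} {p : ℝ} (k : ℕ) :
    limitFreq l p (k + 1) = ((if k = 0 then 1 else 0) + p / l * (upaH l p k - upaH l p (k + 1))
      + (1 - p) * k / 2 * limitFreq l p k) / (1 + (1 - p) * (k + 1) / 2) := by
  rw [limitFreq, upaH_eq_sum_windowFreq, upaH_eq_sum_windowFreq, Finset.sum_sub_distrib]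

theorem upaH_eq_zero {l : ℕ} {p : ℝ} {k : ℕ} (h : l < k) : upaH l p k = 0 :=
  if_neg (by omega)

theorem limitFreq_one (l : ℕ) {p : ℝ} (hp1 : p ≤ 1) :
    limitFreq l p 1 = 2 / (3 - p) * (1 - p / l) ^ l := by
  have h0 : upaH l p 0 = 0 := if_neg (by omega)
  have hw : ∀ i, windowFreq (p / l) i 1 = (1 - p / l) ^ i := by
    intro i
    simpa using windowFreq_eq_choose (p / l) i 0
  have h1 : p / l * upaH l p 1 = 1 - (1 - p / l) ^ l := by
    rw [upaH_eq_sum_windowFreq]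
    simp only [hw]
    have := mul_neg_geom_sum (1 - p / (l : ℝ)) l
    linear_combination this
  have h3 : 3 - p ≠ 0 := by linarith
  have h3' : 1 + (1 - p) / 2 ≠ 0 := by linarith
  have hs := limitFreq_succ (l := l) (p := p) 0
  rw [h0] at hs
  rw [show limitFreq l p 1 = limitFreq l p (0 + 1) from rfl, hs]
  simp only [Nat.cast_zero, zero_add, mul_zero, zero_div, zero_mul, add_zero, if_true, zero_sub,
    mul_neg, h1, mul_one]
  rw [div_mul_eq_mul_div, div_eq_div_iff h3' h3]
  ring

theorem limitFreq_of_two_le {l : ℕ} {p : ℝ} (hp1 : p ≤ 1) {k : ℕ} (hk : 2 ≤ k) :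
    limitFreq l p k = 2 / (2 + k * (1 - p)) *
      (p / l * (upaH l p (k - 1) - upaH l p k)
        + (1 - p) * ((k : ℝ) - 1) / 2 * limitFreq l p (k - 1)) := by
  obtain ⟨k, rfl⟩ : ∃ m, k = m + 1 := ⟨k - 1, by omega⟩
  have hp : 0 ≤ 1 - p := by linarith
  have h1 : 1 + (1 - p) * ((k : ℝ) + 1) / 2 ≠ 0 := by positivity
  have h2 : 2 + ((k : ℝ) + 1) * (1 - p) ≠ 0 := by positivity
  rw [limitFreq_succ, if_neg (by omega), Nat.add_sub_cancel]
  push_cast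
  rw [div_mul_eq_mul_div 2, div_eq_div_iff h1 h2]
  ring

/-- Beyond degree `l + 1` the window no longer contributes. -/
theorem limitFreq_succ_of_lt {l : ℕ} (hl : 1 ≤ l) {p : ℝ} (hp1 : p ≤ 1) {k : ℕ} (hk : l < k) :
    limitFreq l p (k + 1) = (1 - p) * k / (2 + (k + 1) * (1 - p)) * limitFreq l p k := by
  rw [limitFreq_of_two_le hp1 (by omega), Nat.add_sub_cancel, upaH_eq_zero hk,
    upaH_eq_zero (by omega)]
  push_cast
  ring

theorem limitFreq_eq_zero {l : ℕ} (hl : 1 ≤ l) {k : ℕ} (hk : l + 1 < k) :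
    limitFreq l 1 k = 0 := by
  obtain ⟨k, rfl⟩ : ∃ m, k = m + 1 := ⟨k - 1, by omega⟩
  rw [limitFreq_succ_of_lt hl le_rfl (by omega)]
  simp

/-- The solution of the homogeneous recursion in terms of the Gamma function. -/
theorem limitFreq_eq_Gamma {l : ℕ} (hl : 1 ≤ l) {p : ℝ} (hp : p < 1) {k : ℕ} (hk : l + 1 ≤ k) :
    limitFreq l p k = Real.Gamma k * Real.Gamma (l + 2 + 2 / (1 - p)) /
      (Real.Gamma (l + 1) * Real.Gamma (k + 1 + 2 / (1 - p))) * limitFreq l p (l + 1) := by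
  have hp' : 0 < 1 - p := by linarith
  have hc : 0 < 2 / (1 - p) := by positivity
  induction k, hk using Nat.le_induction with
  | base =>
    push_cast
    rw [show (l : ℝ) + 1 + 1 + 2 / (1 - p) = l + 2 + 2 / (1 - p) by ring, div_self, one_mul]
    have := Real.Gamma_pos_of_pos (by positivity : 0 < (l : ℝ) + 1)
    have := Real.Gamma_pos_of_pos (by positivity : 0 < (l : ℝ) + 2 + 2 / (1 - p))
    positivity
  | succ k hk ih =>
    have hk0 : (k : ℝ) ≠ 0 := by
      have : 0 < k := by omega
      positivity
    have hk2 : (k : ℝ) + 1 + 2 / (1 - p) ≠ 0 := by positivity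
    rw [limitFreq_succ_of_lt hl hp.le (by omega), ih]
    push_cast
    rw [Real.Gamma_add_one hk0,
      show (k : ℝ) + 1 + 1 + 2 / (1 - p) = (k + 1 + 2 / (1 - p)) + 1 by ring,
      Real.Gamma_add_one hk2]
    have hr : (1 - p) * k / (2 + (k + 1) * (1 - p)) = k / (k + 1 + 2 / (1 - p)) := by
      field_simp
      ring
    rw [hr]
    have h1 := (Real.Gamma_pos_of_pos (by positivity : 0 < (l : ℝ) + 1)).ne'
    have h2 := (Real.Gamma_pos_of_pos (by positivity : 0 < (k : ℝ) + 1 + 2 / (1 - p))).ne'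
    generalize Real.Gamma ((k : ℝ) + 1 + 2 / (1 - p)) = A at *
    generalize (k : ℝ) + 1 + 2 / (1 - p) = B at *
    field_simp

theorem theorem3p1 (l : ℕ) (hl : 1 ≤ l) (p : ℝ) (hp0 : 0 ≤ p) (hp1 : p ≤ 1) :
    ∃ P : ℕ → ℝ,
      (∀ (Ω : Type*) [MeasurableSpace Ω] (μ : Measure Ω) [IsProbabilityMeasure μ]
          (Y : ℕ → Ω → ℕ), IsUPAProcess l p μ Y →
        ∀ k : ℕ, 1 ≤ k →
          TendstoInMeasure μ
            (fun (t : ℕ) (ω : Ω) => (upaCount (fun i => Y i ω) k t : ℝ) / (t : ℝ))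
            atTop (fun _ => P k)) ∧
      (l = 1 →
        P 1 = 2 * (1 - p) / (3 - p) ∧
        P 2 = (1 - p) ^ 2 / ((2 - p) * (3 - p)) + p / (2 - p) ∧
        (p < 1 → ∀ k : ℕ, 2 < k →
          P k = (2 / (1 - p) + 2) * (2 / (1 - p) + 1) *
            ProbabilityTheory.beta (k : ℝ) (1 + 2 / (1 - p)) * P 2) ∧
        (p = 1 → ∀ k : ℕ, 2 < k → P k = 0)) ∧
      (1 < l →
        P 1 = 2 / (3 - p) * (1 - p / l) ^ l ∧
        (∀ k : ℕ, 2 ≤ k → k ≤ l + 1 →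
          P k = 2 / (2 + k * (1 - p)) *
            (p / l * (upaH l p (k - 1) - upaH l p k)
              + (1 - p) * ((k : ℝ) - 1) / 2 * P (k - 1))) ∧
        (p < 1 → ∀ k : ℕ, l + 1 < k →
          P k = ProbabilityTheory.beta (k : ℝ) (l + 2 + 2 / (1 - p)) /
            ProbabilityTheory.beta ((l : ℝ) + 1) (k + 1 + 2 / (1 - p)) * P (l + 1)) ∧
        (p = 1 → ∀ k : ℕ, l + 1 < k → P k = 0)) := by
  refine ⟨limitFreq l p, fun Ω _ μ _ Y h k hk => h.tendstoInMeasure hl hp0 hp1 hk, ?_, ?_⟩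
  · rintro rfl
    have hP1 : limitFreq 1 p 1 = 2 * (1 - p) / (3 - p) := by
      rw [limitFreq_one 1 hp1]
      push_cast
      ring
    refine ⟨hP1, ?_, fun hp k hk => ?_, ?_⟩
    · have hH : upaH 1 p 1 = 1 := by simp [upaH]
      have h2 : 2 - p ≠ 0 := by linarith
      have h3 : 3 - p ≠ 0 := by linarith
      have h4 : 2 + 2 * (1 - p) ≠ 0 := by linarith
      rw [limitFreq_of_two_le hp1 le_rfl, upaH_eq_zero (by omega : 1 < 2), Nat.add_one_sub_one, hH,
        hP1]
      push_cast
      rw [show 2 + 2 * (1 - p) = 2 * (2 - p) by ring]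
      field_simp
      ring
    · have hp' : 0 < 1 - p := by linarith
      have hc : 0 < 2 / (1 - p) := by positivity
      rw [limitFreq_eq_Gamma le_rfl hp (by omega), beta]
      generalize 2 / (1 - p) = c at *
      have e1 : Real.Gamma (((1 : ℕ) : ℝ) + 2 + c) = (c + 2) * ((c + 1) * Real.Gamma (1 + c)) := by
        rw [show ((1 : ℕ) : ℝ) + 2 + c = (c + 1 + 1) + 1 by push_cast; ring,
          Real.Gamma_add_one (by positivity), Real.Gamma_add_one (by positivity), add_comm 1 c]
        ring
      have e2 : Real.Gamma (((1 : ℕ) : ℝ) + 1) = 1 := by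
        rw [Nat.cast_one, one_add_one_eq_two, Real.Gamma_two]
      rw [e1, e2, add_assoc (k : ℝ) 1 c]
      ring
    · rintro rfl k hk
      exact limitFreq_eq_zero le_rfl hk
  · intro _
    refine ⟨limitFreq_one l hp1, fun k hk _ => limitFreq_of_two_le hp1 hk, fun hp k hk => ?_, ?_⟩
    · have hp' : 0 < 1 - p := by linarith
      have hc : 0 < 2 / (1 - p) := by positivity
      rw [limitFreq_eq_Gamma hl hp hk.le, beta, beta]
      generalize 2 / (1 - p) = c at *
      rw [show (l : ℝ) + 1 + (k + 1 + c) = k + (l + 2 + c) by ring]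
      have h1 := (Real.Gamma_pos_of_pos (by positivity : 0 < (k : ℝ) + (l + 2 + c))).ne'
      rw [div_div_div_cancel_right₀ h1]
    · rintro rfl k hk
      exact limitFreq_eq_zero hl hk
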